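/- All digraphs are without parallel edges and of arbitrary cardinality, and all subdigraphs are spanning, i.e. given by a subset of the edge set. Let $D$ be a digraph with root $r\in V(D)$. A set of directed paths from $r$ to a vertex $v\neq r$ is an $(r,v)$-path-system if any two distinct members have only $r$ and $v$ in common. For a digraph $H$ with root $r$ and $v\neq r$, let $\mathrm{in}_H(v)$ be the set of ingoing edges of $v$ in $H$, and let $\mathcal G_H(v)$ be the family of those $I\subseteq \mathrm{in}_H(v)$ for which some $(r,v)$-path-system in $H$ has $I$ as its set of last edges. - $H$ is a vertex-flame if $\mathrm{in}_H(v)\in\mathcal G_H(v)$ for every vertex $v\ne r$. - For $G\subseteq H$, the digraph $H$ is a $G$-quasi-flame if for every vertex $v\neq r$, every $I\subseteq \mathrm{in}_H(v)$ with $I\setminus \mathrm{in}_G(v)$ finite belongs to $\mathcal G_H(v)$. - A subdigraph $L\subseteq H$ is $H$-large if for every vertex $v\neq r$: (i) there are an $(r,v)$-path-system $\mathcal P$ in $H-rv$, all of whose paths lie in $L$, and a set $S\subseteq V(H)\setminus\{r,v\}$ meeting every directed path from $r$ to $v$ in $H-rv$, such that every path in $\mathcal P$ contains exactly one vertex of $S$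 and every vertex of $S$ lies on a path in $\mathcal P$; and (ii) if $rv\in E(H)$ then $rv\in E(L)$. **Corollary.** For every vertex-flame $F\subseteq D$ there is a subdigraph $Z$ with $F\subseteq Z\subseteq D$ such that $Z$ is an $F$-quasi-flame and every $Z$-large subdigraph $L\subseteq Z$ is also $D$-large. -/

import Mathlib

namespace Digraph

/-- `D.IsPath x y p`: the list `p` is the vertex sequence of a directed path of `D` with initial
vertex `x` and terminal vertex `y`. As `D` has no parallel edges, a path is determined by its
vertex sequence. -/
structure IsPath {V : Type*} (D : Digraph V) (x y : V) (p : List V) : Prop where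
  /-- the path starts at `x` -/
  head : p.head? = some x
  /-- the path ends at `y` -/
  last : p.getLast? = some y
  /-- consecutive vertices are joined by an edge of `D` -/
  chain : p.IsChain D.Adj
  /-- no vertex is repeated -/
  nodup : p.Nodup

/-- An `(x, y)`-path-system of `D`: a set of `(x, y)`-paths of `D` that are pairwise internally
disjoint. -/
structure IsPathSystem {V : Type*} (D : Digraph V) (x y : V) (P : Set (List V)) : Prop where
  /-- every member is an `(x, y)`-path -/
  isPath : ∀ p ∈ P, D.IsPath x y p
  /-- distinct members share only their end vertices -/
  disjoint : ∀ p ∈ P, ∀ q ∈ P, p ≠ q → ∀ z, z ∈ p → z ∈ q → z = x ∨ z = y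

/-- An `(x, y)`-separation of `D`: a set of vertices other than `x` and `y` that meets every
`(x, y)`-path of `D`. -/
structure IsSeparation {V : Type*} (D : Digraph V) (x y : V) (S : Set V) : Prop where
  /-- `x` is not in the separation -/
  left_notMem : x ∉ S
  /-- `y` is not in the separation -/
  right_notMem : y ∉ S
  /-- every `(x, y)`-path meets the separation -/
  meets : ∀ p, D.IsPath x y p → ∃ s ∈ S, s ∈ p

/-- A set `P` of paths and a set `S` of vertices are orthogonal: every path in `P` contains exactly
one vertex of `S`, and every vertex of `S` lies on a path in `P`. -/
def Orthogonal {V : Type*} (P : Set (List V)) (S : Set V) : Prop :=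
  (∀ p ∈ P, ∃! s, s ∈ p ∧ s ∈ S) ∧ ∀ s ∈ S, ∃ p ∈ P, s ∈ p

/-- `P` is an Erdős–Menger `(x, y)`-path-system of `D`: an `(x, y)`-path-system that is orthogonal
to some `(x, y)`-separation. -/
def IsErdosMenger {V : Type*} (D : Digraph V) (x y : V) (P : Set (List V)) : Prop :=
  D.IsPathSystem x y P ∧ ∃ S, D.IsSeparation x y S ∧ Orthogonal P S

/-- The digraph `D - xy`, obtained from `D` by deleting the edge `xy` (if it is present). -/
def deleteEdge {V : Type*} (D : Digraph V) (x y : V) : Digraph V where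
  Adj a b := D.Adj a b ∧ ¬(a = x ∧ b = y)

/-- The set of ingoing edges of `v` in `D`; the edge from `a` to `b` is the pair `(a, b)`. -/
def inEdges {V : Type*} (D : Digraph V) (v : V) : Set (V × V) :=
  {e | D.Adj e.1 e.2 ∧ e.2 = v}

/-- The set of terminal (that is, last) edges of the paths in `P`. -/
def terminalEdges {V : Type*} (P : Set (List V)) : Set (V × V) :=
  {e | ∃ p ∈ P, [e.1, e.2] <:+ p}

/-- The family of all sets `I` of ingoing edges of `v` in `D` such that `I` is the set of terminal
edges of some `(r, v)`-path-system of `D`. -/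
def linkedInSets {V : Type*} (D : Digraph V) (r v : V) : Set (Set (V × V)) :=
  {I | I ⊆ D.inEdges v ∧ ∃ P, D.IsPathSystem r v P ∧ I = terminalEdges P}

/-- `F`, rooted at `r`, is a vertex-flame. -/
def IsVertexFlame {V : Type*} (F : Digraph V) (r : V) : Prop :=
  ∀ v, v ≠ r → F.inEdges v ∈ F.linkedInSets r v

/-- `Z`, rooted at `r`, is a `G`-quasi-flame; the notion presupposes that `G` is a subdigraph
of `Z`. -/
structure IsQuasiFlame {V : Type*} (Z : Digraph V) (r : V) (G : Digraph V) : Prop where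
  /-- `G` is a subdigraph of `Z` -/
  le : G ≤ Z
  /-- the `G`-quasi-flame property holds at every vertex other than the root -/
  mem : ∀ v, v ≠ r → ∀ I, I ⊆ Z.inEdges v → (I \ G.inEdges v).Finite → I ∈ Z.linkedInSets r v

/-- `L` is `v`-large with respect to `D`, rooted at `r`: some Erdős–Menger `(r, v)`-path-system of
`D - rv` lies in `L`, and `L` contains the edge `rv` if `D` does. -/
def IsLargeAt {V : Type*} (D : Digraph V) (r : V) (L : Digraph V) (v : V) : Prop :=
  (∃ P, (D.deleteEdge r v).IsErdosMenger r v P ∧ ∀ p ∈ P, L.IsPath r v p) ∧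
    (D.Adj r v → L.Adj r v)

/-- `L` is `D`-large, for `D` rooted at `r`: it is a spanning subdigraph of `D` that is `v`-large
with respect to `D` for every vertex `v` other than the root. -/
structure IsLarge {V : Type*} (D : Digraph V) (r : V) (L : Digraph V) : Prop where
  /-- `L` is a spanning subdigraph of `D` -/
  le : L ≤ D
  /-- `L` is `v`-large for every `v` other than the root -/
  largeAt : ∀ v, v ≠ r → D.IsLargeAt r L v

end Digraph

/-! By Zorn, let `Z` be maximal among the `F`-quasi-flames below `D`
(`exists_maximal_isQuasiFlame`).

Let `Q` be an Erdős–Menger system of `Z - rw` lying in a `Z`-large `L`. The same `Q` serves for `D -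
rw`; only the separation has to be changed. Let `A` be the set of vertices reached from `r` by
augmenting walks with respect to `Q`, and let `T` consist of the first vertex outside `A` on each
path of `Q`. Because `Q` is orthogonal to a separation, no augmenting walk reaches `w`, so `T` is
orthogonal to `Q` and every edge of `Z - rw` leaving `A` ends in `T` (`exists_separation_fan`).

If `T` did not separate in `D - rw`, some edge `uv` of `D - rw` would lead from `A` out of `A ∪ T`.
For `u ≠ r`, augmenting towards `u` yields a fan from `r` to `T ∪ {u}` inside `A ∪ T`; for `u = r` a
trivial fan will do. Given any path system of `Z` ending in `v`, replace initial segments by fan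
paths and add the path through `uv` (`insert_mem_linkedInSets`). Hence `Z + uv` is still a
quasi-flame, maximality puts `uv` in `Z`, and this contradicts the closure property of `A ∪ T`. -/

namespace Digraph

/-! ### Augmenting systems of disjoint paths coded by predecessor maps -/

/-- `g` encodes a system of paths of `H` starting at `r`, pairwise disjoint apart from `r`, by
sending each vertex on a path to its predecessor and each uncovered vertex to itself.
The vertices of `T` are not predecessors of anything. -/
structure IsBackMap {V : Type*} (H : Digraph V) (r : V) (T : Set V) (g : V → V) : Prop where
  root : g r = r
  adj : ∀ x, g x = x ∨ H.Adj (g x) x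
  inj : ∀ x y, g x = g y → g x ≠ r → x = y
  notMem : ∀ x, g x ∉ T
  finite : ∀ x, (Set.range fun n => g^[n] x).Finite

/-- A vertex is free for `g` if it is the root or may be used as a new predecessor. -/
def IsFree {V : Type*} (r : V) (T : Set V) (g : V → V) (f : V) : Prop :=
  f = r ∨ (f ∉ T ∧ ∀ x, g x ≠ f)

section BackMap

variable {V : Type*} {H : Digraph V} {r : V} {T : Set V} {g : V → V}

theorem IsBackMap.root_notMem (hg : IsBackMap H r T g) : r ∉ T := by
  have := hg.notMem r
  rwa [hg.root] at this

-- An orbit that meets `y` continues along the old orbit of `f`, so orbits stay finite. Injectivity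
-- survives because a free vertex other than the root was not a value of `g`. Taking `f = y`
-- uncovers `y`.
open Classical in
theorem IsBackMap.update (hg : IsBackMap H r T g) {y f : V} (hf : IsFree r T g f) (hy : y ≠ r)
    (hyf : f = y ∨ H.Adj f y) : IsBackMap H r T (Function.update g y f) := by
  have hfT : f ∉ T := by
    rcases hf with rfl | h
    exacts [hg.root_notMem, h.1]
  refine ⟨?_, fun x => ?_, fun a b hab hr => ?_, fun x => ?_, fun x => ?_⟩
  · rw [Function.update_of_ne hy.symm, hg.root]
  · by_cases hx : x = y
    · subst hx; simpa using hyf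
    · rw [Function.update_of_ne hx]; exact hg.adj x
  · by_cases ha : a = y <;> by_cases hb : b = y
    · rw [ha, hb]
    · rw [ha, Function.update_self, Function.update_of_ne hb] at hab
      rw [ha, Function.update_self] at hr
      exact absurd hab.symm ((hf.resolve_left hr).2 b)
    · rw [hb, Function.update_self, Function.update_of_ne ha] at hab
      rw [Function.update_of_ne ha, hab] at hr
      exact absurd hab ((hf.resolve_left hr).2 a)
    · rw [Function.update_of_ne ha, Function.update_of_ne hb] at hab
      rw [Function.update_of_ne ha] at hr
      exact hg.inj a b hab hr
  · by_cases hx : x = y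
    · subst hx; simpa using hfT
    · rw [Function.update_of_ne hx]; exact hg.notMem x
  · refine ((hg.finite x).union (hg.finite f)).subset ?_
    rintro _ ⟨n, rfl⟩
    induction n with
    | zero => exact Or.inl ⟨0, rfl⟩
    | succ n ih =>
      simp only [Function.iterate_succ_apply']
      by_cases hx : (Function.update g y f)^[n] x = y
      · rw [hx, Function.update_self]; exact Or.inr ⟨0, rfl⟩
      · rw [Function.update_of_ne hx]
        rcases ih with ⟨m, hm⟩ | ⟨m, hm⟩
        · exact Or.inl ⟨m + 1, by simpa only [Function.iterate_succ_apply'] using congrArg g hm⟩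
        · exact Or.inr ⟨m + 1, by simpa only [Function.iterate_succ_apply'] using congrArg g hm⟩

/-- Augmentation along an alternating chain from a free vertex. -/
theorem IsBackMap.augment (k : ℕ) : ∀ {g : V → V} {c : ℕ → V}, IsBackMap H r T g →
    IsFree r T g (c k) →
    (∀ i < k, ∃ y, g y = c i ∧ (c (i + 1) = y ∨ H.Adj (c (i + 1)) y)) →
    ∃ g', IsBackMap H r T g' ∧ IsFree r T g' (c 0) := by
  classical
  induction k using Nat.strong_induction_on with
  | _ k ih =>
    intro g c hg hf hc
    rcases k with _ | k
    · exact ⟨g, hg, hf⟩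
    -- The root is always free, so the chain may be cut at it.
    by_cases hr : c k = r
    · exact ih k k.lt_succ_self hg (Or.inl hr) fun i hi => hc i (by omega)
    -- A repetition allows a shortcut. Without one, changing the predecessor of `y` leaves all
    -- earlier links intact.
    by_cases hrep : ∃ i < k, c i = c k
    · obtain ⟨i, hik, hi⟩ := hrep
      have := ih (i + 1) (by omega) (g := g) (c := fun j => if j ≤ i then c j else c (k + 1)) hg
        (by simpa using hf) ?_
      · simpa using this
      intro j hj
      rcases Nat.lt_succ_iff_lt_or_eq.1 hj with hji | rfl
      · simpa [hji.le, Nat.succ_le_of_lt hji] using hc j (by omega)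
      · simpa [hi] using hc k (by omega)
    · push Not at hrep
      obtain ⟨y, hy, hya⟩ := hc k (by omega)
      have hyr : y ≠ r := by
        rintro rfl
        exact hr (by rw [← hy, hg.root])
      -- Handing `y` over to the free vertex `c (k + 1)` frees its old predecessor `c k`.
      have hg' := hg.update hf hyr hya
      refine ih k k.lt_succ_self hg' (Or.inr ⟨?_, fun x hx => ?_⟩) fun i hi => ?_
      · rw [← hy]; exact hg.notMem y
      · by_cases hxy : x = y
        · rw [hxy, Function.update_self] at hx
          rcases hf with h | h
          · exact hr (by rw [← hx, h])
          · exact h.2 y (hy.trans hx.symm)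
        · rw [Function.update_of_ne hxy] at hx
          exact hxy (hg.inj x y (hx.trans hy.symm) (by rwa [hx]))
      · obtain ⟨x, hx, hxa⟩ := hc i (by omega)
        refine ⟨x, ?_, hxa⟩
        rw [Function.update_of_ne, hx]
        rintro rfl
        exact hrep i hi (hx.symm.trans hy)

/-- Iterates of a back map cancel away from the root. -/
theorem IsBackMap.eq_iterate_sub (hg : IsBackMap H r T g) {s t : V} :
    ∀ {i j : ℕ}, i ≤ j → g^[i] s = g^[j] t → g^[i] s ≠ r → s = g^[j - i] t := by
  intro i
  induction i with
  | zero => intro j _ h _; simpa using h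
  | succ i ih =>
    intro j hij h hr
    obtain ⟨j, rfl⟩ : ∃ j', j = j' + 1 := ⟨j - 1, by omega⟩
    rw [Function.iterate_succ_apply', Function.iterate_succ_apply'] at h
    rw [Function.iterate_succ_apply'] at hr
    have h' := hg.inj _ _ h hr
    have := ih (j := j) (by omega) h' (fun h0 => hr (by rw [h0, hg.root]))
    simpa using this

/-- A vertex that is not a predecessor is the end of a path encoded by `g`. -/
theorem IsBackMap.exists_isPath (hg : IsBackMap H r T g) {t : V}
    (htg : ∀ x, g x ≠ t) : ∃ l, H.IsPath r t l ∧ ∀ z ∈ l, ∃ n, g^[n] t = z := by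
  classical
  have hcyc : ∀ i j, i < j → g^[i] t = g^[j] t → g^[i] t = r := by
    intro i j hij h
    by_contra hr
    have := hg.eq_iterate_sub hij.le h hr
    obtain ⟨m, hm⟩ : ∃ m, j - i = m + 1 := ⟨j - i - 1, by omega⟩
    rw [hm, Function.iterate_succ_apply'] at this
    exact htg _ this.symm
  -- The orbit is finite, so a value repeats; unless it is the root, cancelling makes `t` a
  -- predecessor.
  have hex : ∃ n, g^[n] t = r := by
    have : ¬ Function.Injective fun n => g^[n] t := fun h =>
      Set.infinite_range_of_injective h (hg.finite t)
    rw [Function.Injective] at this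
    push Not at this
    obtain ⟨i, j, hij, hne⟩ := this
    rcases lt_or_gt_of_ne hne with h | h
    · exact ⟨i, hcyc i j h hij⟩
    · exact ⟨j, hcyc j i h hij.symm⟩
  set n := Nat.find hex with hn
  have hnr : g^[n] t = r := Nat.find_spec hex
  have hmin : ∀ i < n, g^[i] t ≠ r := fun i hi => Nat.find_min hex hi
  have hstep : ∀ i < n, H.Adj (g^[i + 1] t) (g^[i] t) := by
    intro i hi
    rw [Function.iterate_succ_apply']
    refine (hg.adj _).resolve_left fun h => hmin i hi (hcyc i (i + 1) i.lt_succ_self ?_)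
    rw [Function.iterate_succ_apply', h]
  refine ⟨((List.range (n + 1)).map fun i => g^[i] t).reverse, ⟨?_, ?_, ?_, ?_⟩, ?_⟩
  · rw [List.head?_reverse, List.range_succ]
    simp [hnr]
  · rw [List.getLast?_reverse, List.range_succ_eq_map]
    simp
  · rw [List.isChain_reverse, List.isChain_map, List.isChain_range]
    intro m hm
    exact hstep m (by omega)
  · rw [List.nodup_reverse, List.nodup_map_iff_inj_on List.nodup_range]
    intro i hi j hj hij
    rw [List.mem_range] at hi hj
    by_contra hne
    rcases lt_or_gt_of_ne hne with h | h
    · exact hmin i (by omega) (hcyc i j h hij)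
    · exact hmin j (by omega) (hcyc j i h hij.symm)
  · intro z hz
    simp only [List.mem_reverse, List.mem_map] at hz
    obtain ⟨i, -, hi⟩ := hz
    exact ⟨i, hi⟩

/-- The vertices that are not predecessors are joined to the root by a fan of paths. -/
theorem IsBackMap.exists_fan (hg : IsBackMap H r T g) : ∃ φ : V → List V,
    (∀ t, (∀ x, g x ≠ t) → H.IsPath r t (φ t)) ∧
    ∀ s t, (∀ x, g x ≠ s) → (∀ x, g x ≠ t) → s ≠ t → ∀ z ∈ φ s, z ∈ φ t → z = r := by
  have h : ∀ t, ∃ l, (∀ x, g x ≠ t) → H.IsPath r t l ∧ ∀ z ∈ l, ∃ n, g^[n] t = z := by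
    intro t
    by_cases ht : ∀ x, g x ≠ t
    · obtain ⟨l, hl⟩ := hg.exists_isPath ht
      exact ⟨l, fun _ => hl⟩
    · exact ⟨[], fun h => absurd h ht⟩
  choose φ hφ using h
  have key : ∀ s t, (∀ x, g x ≠ s) → s ≠ t → ∀ i j, i ≤ j → g^[i] s = g^[j] t → g^[i] s = r := by
    intro s t hs hst i j hij h
    by_contra hr
    have := hg.eq_iterate_sub hij h hr
    rcases hm : j - i with _ | m
    · rw [hm] at this; exact hst this
    · rw [hm, Function.iterate_succ_apply'] at this
      exact hs _ this.symm
  refine ⟨φ, fun t h => (hφ t h).1, fun s t hsg htg hst z hzs hzt => ?_⟩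
  obtain ⟨i, hi⟩ := (hφ s hsg).2 z hzs
  obtain ⟨j, hj⟩ := (hφ t htg).2 z hzt
  rcases le_total i j with h | h
  · rw [← hi]; exact key s t hsg hst i j h (hi.trans hj.symm)
  · rw [← hj]; exact key t s htg hst.symm j i h (hj.trans hi.symm)

end BackMap

/-! ### Paths as vertex lists -/

section Path

variable {V : Type*} {H : Digraph V} {r w : V} {q : List V}

theorem IsPath.mono {G : Digraph V} (hq : H.IsPath r w q) (h : H ≤ G) : G.IsPath r w q :=
  ⟨hq.head, hq.last, hq.chain.imp fun _ _ hab => h hab, hq.nodup⟩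

theorem IsPath.getElem?_zero (hq : H.IsPath r w q) : q[0]? = some r := by
  rw [← List.head?_eq_getElem?, hq.head]

theorem IsPath.left_mem (hq : H.IsPath r w q) : r ∈ q :=
  List.mem_of_getElem? hq.getElem?_zero

theorem IsPath.right_mem (hq : H.IsPath r w q) : w ∈ q :=
  List.mem_of_getLast? hq.last

theorem IsPath.index_inj (hq : H.IsPath r w q) {i j : ℕ} {x : V} (hi : q[i]? = some x)
    (hj : q[j]? = some x) : i = j := by
  obtain ⟨h, -⟩ := List.getElem?_eq_some_iff.1 hi
  exact (List.getElem?_inj h hq.nodup).1 (hi.trans hj.symm)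

theorem IsPath.adj_of_index (hq : H.IsPath r w q) {i : ℕ} {x y : V} (hi : q[i]? = some x)
    (hj : q[i + 1]? = some y) : H.Adj x y := by
  obtain ⟨h, rfl⟩ := List.getElem?_eq_some_iff.1 hi
  obtain ⟨h', rfl⟩ := List.getElem?_eq_some_iff.1 hj
  exact List.isChain_iff_getElem.1 hq.chain i h'

theorem IsPath.exists_pred (hq : H.IsPath r w q) {x : V} (hx : x ∈ q) (hxr : x ≠ r) :
    ∃ i y, q[i]? = some y ∧ q[i + 1]? = some x := by
  obtain ⟨i, hi⟩ := List.getElem?_of_mem hx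
  rcases i with _ | i
  · rw [hq.getElem?_zero] at hi
    exact absurd (Option.some.inj hi).symm hxr
  · obtain ⟨h, -⟩ := List.getElem?_eq_some_iff.1 hi
    exact ⟨i, q[i], List.getElem?_eq_getElem (by omega), hi⟩

theorem IsPath.getElem?_length (hq : H.IsPath r w q) : q[q.length - 1]? = some w := by
  rw [← List.getLast?_eq_getElem?, hq.last]

theorem IsPath.exists_succ (hq : H.IsPath r w q) {i : ℕ} {x : V} (hx : q[i]? = some x)
    (hxw : x ≠ w) : ∃ y, q[i + 1]? = some y := by
  obtain ⟨h, -⟩ := List.getElem?_eq_some_iff.1 hx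
  by_cases h' : i + 1 < q.length
  · exact ⟨q[i + 1], List.getElem?_eq_getElem h'⟩
  · have : i = q.length - 1 := by omega
    rw [this, hq.getElem?_length] at hx
    exact absurd (Option.some.inj hx).symm hxw

/-- A path leaves every set that contains its first but not its last vertex. -/
theorem IsPath.exists_exit (hq : H.IsPath r w q) {A : Set V} (hr : r ∈ A) (hw : w ∉ A) :
    ∃ i x y, q[i]? = some x ∧ q[i + 1]? = some y ∧ x ∈ A ∧ y ∉ A := by
  by_contra! hno
  have : ∀ (i : ℕ) (x : V), q[i]? = some x → x ∈ A := by
    intro i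
    induction i with
    | zero =>
      intro x hx
      rw [hq.getElem?_zero] at hx
      rwa [← Option.some.inj hx]
    | succ i ih =>
      intro x hx
      obtain ⟨h, -⟩ := List.getElem?_eq_some_iff.1 hx
      have hi : q[i]? = some q[i] := List.getElem?_eq_getElem (by omega)
      exact hno i _ x hi hx (ih _ hi)
  exact hw (this _ _ hq.getElem?_length)

theorem IsPath.eq_of_mem (hq : H.IsPath r r q) {z : V} (hz : z ∈ q) : z = r := by
  have hlen := hq.index_inj hq.getElem?_zero hq.getElem?_length
  obtain ⟨i, hi⟩ := List.getElem?_of_mem hz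
  obtain ⟨hi', -⟩ := List.getElem?_eq_some_iff.1 hi
  obtain rfl : i = 0 := by omega
  exact Option.some.inj (hi.symm.trans hq.getElem?_zero)

theorem exists_isPath_of_reflTransGen {S : Set V} (hr : r ∉ S)
    (h : Relation.ReflTransGen (fun a b => H.Adj a b ∧ b ∉ S) r w) :
    ∃ l, H.IsPath r w l ∧ ∀ z ∈ l, z ∉ S := by
  induction h with
  | refl => exact ⟨[r], ⟨rfl, rfl, by simp, by simp⟩, by simpa using hr⟩
  | @tail a b _ hab ih =>
    obtain ⟨l, hl, hlS⟩ := ih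
    by_cases hb : b ∈ l
    · obtain ⟨s, t, rfl⟩ := List.append_of_mem hb
      have hsub : (s ++ [b]) <+: s ++ b :: t := ⟨t, by simp⟩
      refine ⟨s ++ [b], ⟨?_, by simp, hl.chain.prefix hsub, hl.nodup.sublist hsub.sublist⟩,
        fun z hz => hlS z (hsub.subset hz)⟩
      have := hl.head
      cases s <;> simpa using this
    · refine ⟨l ++ [b], ⟨?_, by simp, ?_, ?_⟩, ?_⟩
      · rw [List.head?_append, hl.head]; rfl
      · refine List.isChain_append.2 ⟨hl.chain, by simp, ?_⟩
        intro x hx y hy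
        rw [hl.last] at hx
        simp at hx hy
        subst hx hy
        exact hab.1
      · refine List.nodup_append.2 ⟨hl.nodup, by simp, ?_⟩
        intro x hx y hy hxy
        simp at hy
        subst hy hxy
        exact hb hx
      · intro z hz
        rcases List.mem_append.1 hz with hz | hz
        · exact hlS z hz
        · simp at hz; rw [hz]; exact hab.2

end Path

/-! ### Augmenting walks and the separation they determine -/

/-- The vertices reached from `r` by augmenting walks with respect to the predecessor map `g` of a
system of `(r, w)`-paths. -/
inductive Augmentable {V : Type*} (H : Digraph V) (r w : V) (g : V → V) : V → Prop
  | root : Augmentable H r w g r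
  | step {z y : V} : Augmentable H r w g z → (z = y ∨ H.Adj z y) → y ≠ w →
      Augmentable H r w g (g y)

section Augmentable

variable {V : Type*} {H : Digraph V} {r w : V} {g : V → V}

/-- The walk is listed backwards, from `u` to `r`, because `IsBackMap.augment` expects the free
vertex at the far end. -/
theorem Augmentable.exists_chain {u : V} (hu : Augmentable H r w g u) :
    ∃ (k : ℕ) (c : ℕ → V), c 0 = u ∧ c k = r ∧ ∀ i < k, ∃ y, g y = c i ∧
      Augmentable H r w g (c i) ∧ Augmentable H r w g (c (i + 1)) ∧
      (c (i + 1) = y ∨ H.Adj (c (i + 1)) y) := by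
  induction hu with
  | root => exact ⟨0, fun _ => r, rfl, rfl, by simp⟩
  | @step z y hz hzy hy ih =>
    obtain ⟨k, c, h0, hk, hc⟩ := ih
    refine ⟨k + 1, fun i => Nat.casesOn i (g y) c, rfl, hk, fun i hi => ?_⟩
    rcases i with _ | i
    · refine ⟨y, rfl, .step hz hzy hy, ?_, ?_⟩
      · simpa only [h0] using hz
      · simpa only [h0] using hzy
    · exact hc i (by omega)

/-- `g` is the predecessor map of the system `Q` of `(r, w)`-paths. -/
structure IsPredMap (r w : V) (Q : Set (List V)) (g : V → V) : Prop where
  pred : ∀ q ∈ Q, ∀ y ∈ q, y ≠ r → y ≠ w → ∃ i, q[i]? = some (g y) ∧ q[i + 1]? = some y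
  fix : ∀ y, (∀ q ∈ Q, y ∈ q → y = r ∨ y = w) → g y = y

variable {Q : Set (List V)} {S : Set V}

theorem IsPathSystem.exists_isPredMap (hQ : H.IsPathSystem r w Q) : ∃ g, IsPredMap r w Q g := by
  have h : ∀ y, ∃ x, (∀ q ∈ Q, y ∈ q → y ≠ r → y ≠ w →
      ∃ i, q[i]? = some x ∧ q[i + 1]? = some y) ∧
      ((∀ q ∈ Q, y ∈ q → y = r ∨ y = w) → x = y) := by
    intro y
    by_cases hy : ∀ q ∈ Q, y ∈ q → y = r ∨ y = w
    · refine ⟨y, fun q hq hyq h1 h2 => ?_, fun _ => rfl⟩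
      exact absurd (hy q hq hyq) (by tauto)
    · have hy' := hy
      push Not at hy
      obtain ⟨q, hq, hyq, hr, hw⟩ := hy
      obtain ⟨i, x, hx, hy⟩ := (hQ.isPath q hq).exists_pred hyq hr
      refine ⟨x, fun p hp hyp _ _ => ?_, fun h => absurd h hy'⟩
      by_cases hpq : q = p
      · subst hpq; exact ⟨i, hx, hy⟩
      · rcases hQ.disjoint q hq p hp hpq y hyq hyp with h | h
        exacts [absurd h hr, absurd h hw]
  choose g hg using h
  exact ⟨g, ⟨fun q hq y => (hg y).1 q hq, fun y => (hg y).2⟩⟩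

theorem IsPredMap.root (hg : IsPredMap r w Q g) : g r = r := hg.fix r fun _ _ _ => Or.inl rfl

theorem IsPredMap.target (hg : IsPredMap r w Q g) : g w = w := hg.fix w fun _ _ _ => Or.inr rfl

theorem IsPredMap.cases (hg : IsPredMap r w Q g) (y : V) :
    (g y = y ∧ (∀ q ∈ Q, y ∈ q → y = r ∨ y = w)) ∨
    (y ≠ r ∧ y ≠ w ∧ ∃ q ∈ Q, ∃ i, q[i]? = some (g y) ∧ q[i + 1]? = some y) := by
  by_cases hy : ∀ q ∈ Q, y ∈ q → y = r ∨ y = w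
  · exact Or.inl ⟨hg.fix y hy, hy⟩
  · push Not at hy
    obtain ⟨q, hq, hyq, hr, hw⟩ := hy
    exact Or.inr ⟨hr, hw, q, hq, hg.pred q hq y hyq hr hw⟩

theorem IsPredMap.inj (hg : IsPredMap r w Q g) (hQ : H.IsPathSystem r w Q) {x y : V}
    (hxy : g x = g y) (hr : g x ≠ r) (hw : g x ≠ w) : x = y := by
  have aux : ∀ x y, g x = g y → g x ≠ r → g x ≠ w → g y = y →
      (∀ q ∈ Q, y ∈ q → y = r ∨ y = w) → x = y := by
    intro x y hxy hr hw hy hyQ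
    rcases hg.cases x with ⟨hx, -⟩ | ⟨-, -, q, hq, i, hi, -⟩
    · rw [← hx, hxy, hy]
    · rw [hxy, hy] at hi hr hw
      rcases hyQ q hq (List.mem_of_getElem? hi) with h | h
      exacts [absurd h hr, absurd h hw]
  rcases hg.cases y with ⟨hy, hyQ⟩ | ⟨-, -, p, hp, j, hj, hj'⟩
  · exact aux x y hxy hr hw hy hyQ
  rcases hg.cases x with ⟨hx, hxQ⟩ | ⟨-, -, q, hq, i, hi, hi'⟩
  · exact (aux y x hxy.symm (hxy ▸ hr) (hxy ▸ hw) hx hxQ).symm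
  · rw [← hxy] at hj
    have hpq : p = q := by
      by_contra hne
      rcases hQ.disjoint p hp q hq hne _ (List.mem_of_getElem? hj) (List.mem_of_getElem? hi)
        with h | h
      exacts [hr h, hw h]
    subst hpq
    have := (hQ.isPath p hp).index_inj hi hj
    subst this
    exact Option.some.inj (hi'.symm.trans hj')

theorem IsPredMap.adj (hg : IsPredMap r w Q g) (hQ : H.IsPathSystem r w Q) (x : V) :
    g x = x ∨ H.Adj (g x) x := by
  rcases hg.cases x with ⟨hx, -⟩ | ⟨-, -, q, hq, i, hi, hi'⟩
  · exact Or.inl hx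
  · exact Or.inr ((hQ.isPath q hq).adj_of_index hi hi')

/-- Augmenting walks do not cross a separation orthogonal to the path system. -/
theorem Augmentable.reflTransGen (hg : IsPredMap r w Q g) (hQ : H.IsPathSystem r w Q)
    (hS : H.IsSeparation r w S) (hO : Orthogonal Q S) {u : V} (hu : Augmentable H r w g u) :
    Relation.ReflTransGen (fun a b => H.Adj a b ∧ b ∉ S) r u := by
  set W : V → Prop := Relation.ReflTransGen (fun a b => H.Adj a b ∧ b ∉ S) r with hW
  have hw : ¬ W w := by
    intro h
    obtain ⟨l, hl, hlS⟩ := exists_isPath_of_reflTransGen hS.left_notMem h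
    obtain ⟨s, hs, hsl⟩ := hS.meets l hl
    exact hlS s hsl hs
  have hWS : ∀ u, W u → u ∉ S := by
    intro u h
    rcases Relation.ReflTransGen.cases_tail h with h | ⟨_, -, -, h⟩
    · rw [h]; exact hS.left_notMem
    · exact h
  induction hu with
  | root => exact .refl
  | @step z y _ hzy hyw ih =>
    have hy : W y ∨ y ∈ S := by
      by_cases hyS : y ∈ S
      · exact Or.inr hyS
      · rcases hzy with rfl | h
        · exact Or.inl ih
        · exact Or.inl (ih.tail ⟨h, hyS⟩)
    rcases hg.cases y with ⟨hgy, hyQ⟩ | ⟨hr, -, q, hq, i, hi, hi'⟩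
    · rw [hgy]
      refine hy.resolve_right fun hyS => ?_
      obtain ⟨p, hp, hyp⟩ := hO.2 y hyS
      rcases hyQ p hp hyp with h | h
      · exact hS.left_notMem (h ▸ hyS)
      · exact hyw h
    · obtain ⟨s, ⟨hsq, hsS⟩, hsu⟩ := hO.1 q hq
      have hp := hQ.isPath q hq
      obtain ⟨k, hk⟩ := List.getElem?_of_mem hsq
      -- After its only vertex `s` in `S`, the path `q` runs to `w` outside `S`. So if `y` lay
      -- beyond `s`, then `w` could be reached without meeting `S`.
      have hik : i + 1 ≤ k := by
        by_contra hlt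
        have hyW : W y := hy.resolve_right fun hyS => by
          have := hsu y ⟨List.mem_of_getElem? hi', hyS⟩
          subst this
          have := hp.index_inj hi' hk
          omega
        have : ∀ m x, q[i + 1 + m]? = some x → W x := by
          intro m
          induction m with
          | zero =>
            intro x hx
            rw [Nat.add_zero, hi'] at hx
            exact Option.some.inj hx ▸ hyW
          | succ m ihm =>
            intro x hx
            obtain ⟨h, -⟩ := List.getElem?_eq_some_iff.1 hx
            have hm : q[i + 1 + m]? = some q[i + 1 + m] := List.getElem?_eq_getElem (by omega)
            refine (ihm _ hm).tail ⟨hp.adj_of_index hm hx, fun hxS => ?_⟩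
            have := hsu x ⟨List.mem_of_getElem? hx, hxS⟩
            subst this
            have := hp.index_inj hx hk
            omega
        obtain ⟨h, -⟩ := List.getElem?_eq_some_iff.1 hi'
        refine hw (this (q.length - 1 - (i + 1)) w ?_)
        rw [← hp.getElem?_length]
        congr 1
        omega
      -- Before `s`, the path `q` is itself a walk from `r` avoiding `S`, and it contains `g y`.
      have : ∀ m x, m < k → q[m]? = some x → W x := by
        intro m
        induction m with
        | zero =>
          intro x _ hx
          rw [hp.getElem?_zero] at hx
          exact Option.some.inj hx ▸ .refl
        | succ m ihm =>
          intro x hmk hx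
          obtain ⟨h, -⟩ := List.getElem?_eq_some_iff.1 hx
          have hm : q[m]? = some q[m] := List.getElem?_eq_getElem (by omega)
          refine (ihm _ (by omega) hm).tail ⟨hp.adj_of_index hm hx, fun hxS => ?_⟩
          have := hsu x ⟨List.mem_of_getElem? hx, hxS⟩
          subst this
          have := hp.index_inj hx hk
          omega
      exact this i _ (by omega) hi

theorem Augmentable.not_adj_target (hg : IsPredMap r w Q g) (hQ : H.IsPathSystem r w Q)
    (hS : H.IsSeparation r w S) (hO : Orthogonal Q S) {u : V} (hu : Augmentable H r w g u) :
    u ≠ w ∧ ¬ H.Adj u w := by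
  have hW := hu.reflTransGen hg hQ hS hO
  have hw : ¬ Relation.ReflTransGen (fun a b => H.Adj a b ∧ b ∉ S) r w := by
    intro h
    obtain ⟨l, hl, hlS⟩ := exists_isPath_of_reflTransGen hS.left_notMem h
    obtain ⟨s, hs, hsl⟩ := hS.meets l hl
    exact hlS s hsl hs
  refine ⟨?_, fun h => hw (hW.tail ⟨h, hS.right_notMem⟩)⟩
  rintro rfl
  exact hw hW

/-- An Erdős–Menger path system is orthogonal to a separation `T` such that every vertex that is
not separated from the root by `T` can be added to the vertices of `T` linked from the root. -/
theorem IsPathSystem.exists_separation_fan (hQ : H.IsPathSystem r w Q)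
    (hS : H.IsSeparation r w S) (hO : Orthogonal Q S) : ∃ A T : Set V,
      r ∈ A ∧ w ∉ A ∧ w ∉ T ∧ Disjoint A T ∧ (∀ a ∈ A, ∀ b, H.Adj a b → b ∈ A ∪ T) ∧
      Orthogonal Q T ∧
      ∀ u ∈ A, u ≠ r → ∃ φ : V → List V,
        (∀ x ∈ insert u T, H.IsPath r x (φ x) ∧ ∀ z ∈ φ x, z ∈ A ∪ T) ∧
        ∀ x ∈ insert u T, ∀ y ∈ insert u T, x ≠ y → ∀ z ∈ φ x, z ∈ φ y → z = r := by
  classical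
  obtain ⟨g, hg⟩ := hQ.exists_isPredMap
  set A : Set V := {z | Augmentable H r w g z} with hA
  -- Each path of `Q` meets `A` in an initial segment, because `g` maps `A` to itself; `T` collects
  -- the vertices that come next.
  set T : Set V := {y | g y ∈ A ∧ y ∉ A} with hT
  have hrA : r ∈ A := .root
  have hnot : ∀ u ∈ A, u ≠ w ∧ ¬ H.Adj u w := fun u hu =>
    Augmentable.not_adj_target hg hQ hS hO hu
  have hwA : w ∉ A := fun h => (hnot w h).1 rfl
  have hgA : ∀ y ∈ A, g y ∈ A := fun y hy => Augmentable.step hy (Or.inl rfl) (hnot y hy).1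
  have hclosed : ∀ a ∈ A, ∀ b, H.Adj a b → b ∈ A ∪ T := by
    intro a ha b hab
    by_cases hb : b ∈ A
    · exact Or.inl hb
    · exact Or.inr ⟨Augmentable.step ha (Or.inr hab) fun h => (hnot a ha).2 (h ▸ hab), hb⟩
  have hwT : w ∉ T := by
    rintro ⟨h, h'⟩
    rw [hg.target] at h
    exact h' h
  have hAT : Disjoint A T := Set.disjoint_left.2 fun x hx hx' => hx'.2 hx
  have hpred : ∀ q ∈ Q, ∀ i x y, q[i]? = some x → q[i + 1]? = some y → y ≠ w → g y = x := by
    intro q hq i x y hx hy hyw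
    have hp := hQ.isPath q hq
    have hyr : y ≠ r := by
      rintro rfl
      have := hp.index_inj hy hp.getElem?_zero
      omega
    obtain ⟨j, hj, hj'⟩ := hg.pred q hq y (List.mem_of_getElem? hy) hyr hyw
    have := hp.index_inj hj' hy
    obtain rfl : j = i := by omega
    exact Option.some.inj (hj.symm.trans hx)
  refine ⟨A, T, hrA, hwA, hwT, hAT, hclosed, ⟨?_, ?_⟩, ?_⟩
  · intro q hq
    have hp := hQ.isPath q hq
    have hinit : ∀ (m i : ℕ) (x y : V), q[i]? = some x → q[i + m]? = some y → y ∈ A → x ∈ A := by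
      intro m
      induction m with
      | zero =>
        intro i x y hx hy hyA
        rw [Nat.add_zero, hx] at hy
        rwa [Option.some.inj hy]
      | succ m ihm =>
        intro i x y hx hy hyA
        obtain ⟨h, -⟩ := List.getElem?_eq_some_iff.1 hy
        have hm : q[i + m]? = some q[i + m] := List.getElem?_eq_getElem (by omega)
        refine ihm i x _ hx hm ?_
        rw [← hpred q hq _ _ y hm hy fun h => hwA (h ▸ hyA)]
        exact hgA y hyA
    have huniq : ∀ (i j : ℕ) (x y : V), q[i]? = some x → q[j]? = some y → x ∈ T → y ∈ T → j ≤ i := by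
      intro i j x y hx hy hxT hyT
      by_contra hij
      obtain ⟨h, -⟩ := List.getElem?_eq_some_iff.1 hy
      obtain ⟨m, rfl⟩ : ∃ m, j = i + m + 1 := ⟨j - i - 1, by omega⟩
      have hm : q[i + m]? = some q[i + m] := List.getElem?_eq_getElem (by omega)
      refine hxT.2 (hinit m i x _ hx hm ?_)
      rw [← hpred q hq _ _ y hm hy fun h => hwT (h ▸ hyT)]
      exact hyT.1
    obtain ⟨i, x, y, hx, hy, hxA, hyA⟩ := hp.exists_exit hrA hwA
    have hyT : y ∈ T := (hclosed x hxA y (hp.adj_of_index hx hy)).resolve_left hyA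
    refine ⟨y, ⟨List.mem_of_getElem? hy, hyT⟩, ?_⟩
    rintro y' ⟨hy'q, hy'T⟩
    obtain ⟨j, hj⟩ := List.getElem?_of_mem hy'q
    have : j = i + 1 := le_antisymm (huniq _ _ _ _ hy hj hyT hy'T) (huniq _ _ _ _ hj hy hy'T hyT)
    subst this
    exact Option.some.inj (hj.symm.trans hy)
  · intro s hs
    rcases hg.cases s with ⟨h, -⟩ | ⟨-, -, q, hq, i, -, hi⟩
    · exact absurd (h ▸ hs.1) hs.2
    · exact ⟨q, hq, List.mem_of_getElem? hi⟩
  · intro u hu hur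
    -- Edges of `K` have their tails in `A`, which keeps the fan inside `A ∪ T`; `k` cuts each path
    -- of `Q` at its vertex in `T`.
    let K : Digraph V := ⟨fun a b => H.Adj a b ∧ a ∈ A⟩
    let k : V → V := fun y => if g y ∈ A then g y else y
    have hk1 : ∀ y, g y ∈ A → k y = g y := fun y h => if_pos h
    have hk2 : ∀ y, g y ∉ A → k y = y := fun y h => if_neg h
    have hK : IsBackMap K r T k := by
      refine ⟨by rw [hk1 r (by rw [hg.root]; exact hrA), hg.root], fun x => ?_,
        fun x y hxy hr => ?_, fun x => ?_, fun x => ?_⟩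
      · by_cases hx : g x ∈ A
        · rw [hk1 x hx]
          exact (hg.adj hQ x).imp_right fun h => ⟨h, hx⟩
        · exact Or.inl (hk2 x hx)
      · by_cases hx : g x ∈ A <;> by_cases hy : g y ∈ A
        · rw [hk1 x hx] at hxy hr
          rw [hk1 y hy] at hxy
          exact hg.inj hQ hxy hr (hnot _ hx).1
        · rw [hk1 x hx, hk2 y hy] at hxy
          exact absurd (hgA y (hxy ▸ hx)) hy
        · rw [hk2 x hx, hk1 y hy] at hxy
          exact absurd (hgA x (hxy ▸ hy)) hx
        · rwa [hk2 x hx, hk2 y hy] at hxy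
      · by_cases hx : g x ∈ A
        · rw [hk1 x hx]; exact fun h => h.2 hx
        · rw [hk2 x hx]; exact fun h => hx h.1
      · by_cases hx : ∃ q ∈ Q, x ∈ q
        · obtain ⟨q, hq, hxq⟩ := hx
          refine (List.finite_toSet q).subset ?_
          rintro _ ⟨n, rfl⟩
          induction n with
          | zero => exact hxq
          | succ n ih =>
            simp only [Function.iterate_succ_apply']
            replace ih : k^[n] x ∈ q := ih
            rw [Set.mem_ofPred_eq]
            generalize k^[n] x = y at ih ⊢
            by_cases hy : g y ∈ A
            · rw [hk1 y hy]
              by_cases hyr : y = r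
              · rw [hyr, hg.root]; exact (hQ.isPath q hq).left_mem
              by_cases hyw : y = w
              · rw [hyw, hg.target]; exact (hQ.isPath q hq).right_mem
              obtain ⟨i, hi, -⟩ := hg.pred q hq y ih hyr hyw
              exact List.mem_of_getElem? hi
            · rwa [hk2 y hy]
        · push Not at hx
          have hfix : k x = x := by
            have : g x = x := hg.fix x fun q hq h => absurd h (hx q hq)
            by_cases h : g x ∈ A
            · rw [hk1 x h, this]
            · exact hk2 x h
          refine (Set.finite_singleton x).subset ?_
          rintro _ ⟨n, rfl⟩
          exact Function.iterate_fixed hfix n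
    obtain ⟨n, c, h0, hn, hc⟩ := hu.exists_chain
    obtain ⟨g', hg', hfree⟩ := hK.augment n (c := c) (Or.inl hn) fun i hi => by
      obtain ⟨y, hy, h1, h2, h3⟩ := hc i hi
      refine ⟨y, ?_, h3.imp_right fun h => ⟨h, h2⟩⟩
      rw [hk1 y (by rw [hy]; exact h1), hy]
    rw [h0] at hfree
    -- Not being a value of `g'` also excludes being fixed, so these vertices are covered and are
    -- ends of paths.
    have hfree' : ∀ x ∈ insert u T, ∀ y, g' y ≠ x := by
      rintro x (rfl | hx)
      · exact (hfree.resolve_left hur).2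
      · rintro y rfl
        exact hg'.notMem y hx
    obtain ⟨φ, hφ, hφd⟩ := hg'.exists_fan
    refine ⟨φ, fun x hx => ⟨(hφ x (hfree' x hx)).mono fun a b h => h.1, fun z hz => ?_⟩,
      fun x hx y hy => hφd x y (hfree' x hx) (hfree' y hy)⟩
    by_cases hzx : z = x
    · subst hzx
      rcases hx with rfl | hx
      exacts [Or.inl hu, Or.inr hx]
    · obtain ⟨i, hi⟩ := List.getElem?_of_mem hz
      obtain ⟨y, hy⟩ := (hφ x (hfree' x hx)).exists_succ hi hzx
      exact Or.inl ((hφ x (hfree' x hx)).adj_of_index hi hy).2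

end Augmentable

/-! ### Linked sets of ingoing edges and rerouting through a fan -/

section Linked

variable {V : Type*} {Z Z' : Digraph V} {r v : V}

theorem inEdges_mono (h : Z ≤ Z') : Z.inEdges v ⊆ Z'.inEdges v :=
  fun _ he => ⟨h he.1, he.2⟩

theorem linkedInSets_mono (h : Z ≤ Z') : Z.linkedInSets r v ⊆ Z'.linkedInSets r v := by
  rintro I ⟨hI, P, hP, rfl⟩
  exact ⟨hI.trans (inEdges_mono h), P, ⟨fun p hp => (hP.isPath p hp).mono h, hP.disjoint⟩, rfl⟩

theorem mem_linkedInSets_of_subset {I J : Set (V × V)} (hIJ : I ⊆ J)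
    (hJ : J ∈ Z.linkedInSets r v) : I ∈ Z.linkedInSets r v := by
  obtain ⟨hJZ, P, hP, rfl⟩ := hJ
  refine ⟨hIJ.trans hJZ, {p | p ∈ P ∧ ∃ e ∈ I, [e.1, e.2] <:+ p},
    ⟨fun p hp => hP.isPath p hp.1, fun p hp q hq => hP.disjoint p hp.1 q hq.1⟩,
    Set.Subset.antisymm (fun e he => ?_) ?_⟩
  · obtain ⟨p, hp, hep⟩ := hIJ he
    exact ⟨p, ⟨hp, e, he, hep⟩, hep⟩
  · rintro e ⟨p, ⟨-, e', he', hep'⟩, hep⟩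
    have := (List.suffix_of_suffix_length_le hep hep' (by simp)).eq_of_length (by simp)
    simp only [List.cons.injEq, and_true] at this
    rwa [Prod.ext this.1 this.2]

theorem exists_append_cons_last {α : Type*} {p : α → Prop} : ∀ {l : List α}, (∃ z ∈ l, p z) →
    ∃ a x t, l = a ++ x :: t ∧ p x ∧ ∀ z ∈ t, ¬ p z := by
  intro l
  induction l with
  | nil => simp
  | cons b l ih =>
    intro h
    by_cases hl : ∃ z ∈ l, p z
    · obtain ⟨a, x, t, rfl, hx, ht⟩ := ih hl
      exact ⟨b :: a, x, t, rfl, hx, ht⟩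
    · push Not at hl
      obtain ⟨z, hz, hpz⟩ := h
      rcases List.mem_cons.1 hz with rfl | hz
      · exact ⟨[], z, l, rfl, hpz, hl⟩
      · exact absurd hpz (hl z hz)

/-- As `t` is nonempty, the last two entries lie in `x :: t`; hence rerouting a path before `x`
keeps its terminal edge. -/
theorem suffix_append_cons_iff {α : Type*} {a b x : α} {l t : List α} (ht : t ≠ []) :
    [a, b] <:+ l ++ x :: t ↔ [a, b] <:+ x :: t := by
  refine ⟨fun h => List.suffix_of_suffix_length_le h (List.suffix_append _ _) ?_,
    fun h => h.trans (List.suffix_append _ _)⟩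
  have := List.length_pos_iff.2 ht
  simp only [List.length_cons, List.length_nil]
  omega

/-- A linked set of ingoing edges of `v` is extended by the edge `uv` by means of a fan. -/
theorem insert_mem_linkedInSets {A T : Set V} {J : Set (V × V)} {u : V} {φ : V → List V}
    (hJ : J ∈ Z.linkedInSets r v) (hr : r ∈ A) (hv : v ∉ A) (hvT : v ∉ T) (hAT : Disjoint A T)
    (hcl : ∀ a ∈ A, a ≠ r → ∀ b, Z.Adj a b → b ∈ A ∪ T) (hu : u ∈ A)
    (hφ : ∀ x ∈ insert u T, Z.IsPath r x (φ x) ∧ ∀ z ∈ φ x, z ∈ A ∪ T)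
    (hd : ∀ x ∈ insert u T, ∀ y ∈ insert u T, x ≠ y → ∀ z ∈ φ x, z ∈ φ y → z = r)
    (hZ : Z ≤ Z') (huv : Z'.Adj u v) : insert (u, v) J ∈ Z'.linkedInSets r v := by
  classical
  obtain ⟨hJZ, P, hP, rfl⟩ := hJ
  have hrv : r ≠ v := fun h => hv (h ▸ hr)
  have hrT : r ∉ T := Set.disjoint_left.1 hAT hr
  -- The root is included because `hcl` says nothing about edges leaving `r`: a path may jump from
  -- `r` out of `A ∪ T`, and its new initial segment is then just `[r]`.
  set X : Set V := insert r T with hX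
  have hvX : v ∉ X := by
    rintro (h | h)
    exacts [hrv h.symm, hvT h]
  obtain ⟨ψ, hψ, hψA, hψd⟩ : ∃ ψ : V → List V, (∀ x ∈ insert u X, Z.IsPath r x (ψ x)) ∧
      (∀ x ∈ insert u X, ∀ z ∈ ψ x, z ∈ A ∪ T) ∧
      ∀ x ∈ insert u X, ∀ y ∈ insert u X, ∀ z ∈ ψ x, z ∈ ψ y → x = y ∨ z = r := by
    have hmem : ∀ x ∈ insert u X, x ≠ r → x ∈ insert u T := by
      rintro x (h | h | h) hx
      exacts [Or.inl h, absurd h hx, Or.inr h]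
    refine ⟨fun x => if x = r then [r] else φ x, fun x hx => ?_, fun x hx z => ?_,
      fun x hx y hy z => ?_⟩
    · by_cases h : x = r
      · subst h; simpa using ⟨rfl, rfl, by simp, by simp⟩
      · simpa [h] using (hφ x (hmem x hx h)).1
    · by_cases h : x = r
      · simp only [h, if_true, List.mem_singleton]
        rintro rfl; exact Or.inl hr
      · simpa only [h, if_false] using (hφ x (hmem x hx h)).2 z
    · by_cases h : x = r
      · simp only [h, if_true, List.mem_singleton]
        exact fun h _ => Or.inr h
      by_cases h' : y = r
      · simp only [h', if_true, List.mem_singleton]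
        exact fun _ h => Or.inr h
      simp only [h, h', if_false]
      intro hzx hzy
      by_cases hxy : x = y
      · exact Or.inl hxy
      · exact Or.inr (hd x (hmem x hx h) y (hmem y hy h') hxy z hzx hzy)
  have hsplit : ∀ p, ∃ a x t, p ∈ P → p = a ++ x :: t ∧ x ∈ X ∧ ∀ z ∈ t, z ∉ X := by
    intro p
    by_cases hp : p ∈ P
    · obtain ⟨a, x, t, h⟩ := exists_append_cons_last (p := fun z => z ∈ X)
        ⟨r, (hP.isPath p hp).left_mem, Or.inl rfl⟩
      exact ⟨a, x, t, fun _ => h⟩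
    · exact ⟨[], r, [], fun h => absurd h hp⟩
  choose a x t hsplit using hsplit
  have hx : ∀ p ∈ P, x p ∈ insert u X := fun p hp => Or.inr (hsplit p hp).2.1
  have hxp : ∀ p ∈ P, x p ∈ p := fun p hp => by
    have h : x p ∈ a p ++ x p :: t p := by simp
    rwa [← (hsplit p hp).1] at h
  have htp : ∀ p ∈ P, ∀ z ∈ t p, z ∈ p := fun p hp z hz => by
    have h : z ∈ a p ++ x p :: t p := by simp [hz]
    rwa [← (hsplit p hp).1] at h
  have ht : ∀ p ∈ P, t p ≠ [] := by
    intro p hp h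
    obtain ⟨h1, h2, -⟩ := hsplit p hp
    have := (hP.isPath p hp).last
    rw [h1, h] at this
    simp at this
    exact hvX (this ▸ h2)
  have htlast : ∀ p ∈ P, (t p).getLast? = some v := by
    intro p hp
    have := (hP.isPath p hp).last
    rw [(hsplit p hp).1] at this
    rw [← this]
    obtain ⟨b, l, hb⟩ := List.exists_cons_of_ne_nil (ht p hp)
    rw [hb, List.getLast?_append, List.getLast?_cons_cons,
      List.getLast?_eq_some_getLast (List.cons_ne_nil b l)]
    rfl
  have htchain : ∀ p ∈ P, (x p :: t p).IsChain Z.Adj := by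
    intro p hp
    have h := (hP.isPath p hp).chain
    rw [(hsplit p hp).1] at h
    exact (List.isChain_append.1 h).2.1
  -- Induction backwards from `v`: a vertex of `A` other than `r` would force its successor on the
  -- path into `A ∪ T`.
  have htA : ∀ p ∈ P, ∀ z ∈ t p, z ∉ A ∪ T := by
    intro p hp
    have key : ∀ l : List V, l.IsChain Z.Adj → l.getLast? = some v → (∀ z ∈ l, z ∉ X) →
        ∀ z ∈ l, z ∉ A ∪ T := by
      intro l
      induction l with
      | nil => simp
      | cons b l ih =>
        intro hch hlast hlX
        rcases l with _ | ⟨c, l⟩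
        · simp only [List.getLast?_singleton, Option.some.injEq] at hlast
          subst hlast
          intro z hz
          rw [List.mem_singleton] at hz
          subst hz
          rintro (h | h)
          exacts [hv h, hvT h]
        · have ih' := ih (List.isChain_cons_cons.1 hch).2
            (by rwa [List.getLast?_cons_cons] at hlast)
            fun z hz => hlX z (List.mem_cons_of_mem _ hz)
          intro z hz
          rcases List.mem_cons.1 hz with rfl | hz
          · have hzX := hlX z (by simp)
            rintro (h | h)
            · exact ih' c (by simp) (hcl z h (fun h => hzX (Or.inl h)) c
                (List.isChain_cons_cons.1 hch).1)
            · exact hzX (Or.inr h)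
          · exact ih' z hz
    exact key (t p) (htchain p hp).tail (htlast p hp) (hsplit p hp).2.2
  have hψx : ∀ y ∈ insert u X, ∃ l, ψ y = l ++ [y] := fun y hy =>
    List.getLast?_eq_some_iff.1 (hψ y hy).last
  have hglue : ∀ y ∈ insert u X, ∀ s : List V, (y :: s).IsChain Z'.Adj → s.getLast? = some v →
      s.Nodup → (∀ z ∈ s, z ∉ A ∪ T) → Z'.IsPath r v (ψ y ++ s) := by
    intro y hy s hch hlast hnd hs
    have hpath := (hψ y hy).mono hZ
    refine ⟨by rw [List.head?_append, hpath.head]; rfl, by rw [List.getLast?_append, hlast]; rfl,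
      List.isChain_append.2 ⟨hpath.chain, hch.tail, ?_⟩,
      List.nodup_append.2 ⟨hpath.nodup, hnd, ?_⟩⟩
    · intro b hb c hc
      rw [hpath.last] at hb
      obtain rfl : y = b := by simpa using hb
      rcases s with _ | ⟨d, s⟩
      · simp at hc
      · obtain rfl : d = c := by simpa using hc
        exact (List.isChain_cons_cons.1 hch).1
    · rintro b hb c hc rfl
      exact hs b hc (hψA y hy b hb)
  have huX : u ∈ insert u X := Or.inl rfl
  refine ⟨?_, (fun p => ψ (x p) ++ t p) '' P ∪ {ψ u ++ [v]}, ⟨?_, ?_⟩, ?_⟩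
  · rintro e (rfl | he)
    · exact ⟨huv, rfl⟩
    · exact inEdges_mono hZ (hJZ he)
  · rintro _ (⟨p, hp, rfl⟩ | rfl)
    · refine hglue _ (hx p hp) _ ((htchain p hp).imp fun _ _ h => hZ h) (htlast p hp) ?_ (htA p hp)
      have h := (hP.isPath p hp).nodup
      rw [(hsplit p hp).1] at h
      exact (List.nodup_cons.1 (List.nodup_append.1 h).2.1).2
    · refine hglue u huX [v] (by simpa using huv) rfl (by simp) ?_
      intro z hz
      obtain rfl : z = v := by simpa using hz
      rintro (h | h)
      exacts [hv h, hvT h]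
  · have haux : ∀ p ∈ P, ∀ z, z ∈ ψ (x p) ++ t p → z ∈ ψ u ++ [v] → z = r ∨ z = v := by
      intro p hp z hz hz'
      rcases List.mem_append.1 hz' with hz' | hz'
      · rcases List.mem_append.1 hz with hz | hz
        · rcases hψd _ (hx p hp) u huX z hz hz' with h | h
          · have hxr : u = r := by
              rcases (hsplit p hp).2.1 with h' | h'
              · rw [← h, h']
              · exact absurd h' (Set.disjoint_left.1 hAT (h ▸ hu))
            have hzr := (hψ u huX)
            rw [hxr] at hzr hz'
            exact Or.inl (hzr.eq_of_mem hz')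
          · exact Or.inl h
        · exact absurd (hψA u huX z hz') (htA p hp z hz)
      · exact Or.inr (by simpa using hz')
    rintro _ (⟨p, hp, rfl⟩ | rfl) _ (⟨q, hq, rfl⟩ | rfl) hne z hz hz'
    · have hpq : p ≠ q := fun h => hne (by rw [h])
      rcases List.mem_append.1 hz with hz | hz <;> rcases List.mem_append.1 hz' with hz' | hz'
      · rcases hψd _ (hx p hp) _ (hx q hq) z hz hz' with h | h
        · have hxr : x p = r := by
            refine (hP.disjoint p hp q hq hpq _ (hxp p hp) (h ▸ hxp q hq)).resolve_right ?_
            intro h'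
            exact hvX (h' ▸ (hsplit p hp).2.1)
          have hzr := hψ _ (hx p hp)
          rw [hxr] at hzr hz
          exact Or.inl (hzr.eq_of_mem hz)
        · exact Or.inl h
      · exact absurd (hψA _ (hx p hp) z hz) (htA q hq z hz')
      · exact absurd (hψA _ (hx q hq) z hz') (htA p hp z hz)
      · exact hP.disjoint p hp q hq hpq z (htp p hp z hz) (htp q hq z hz')
    · exact haux p hp z hz hz'
    · exact haux q hq z hz' hz
    · exact absurd rfl hne
  · have hold : ∀ p ∈ P, ∀ e : V × V, [e.1, e.2] <:+ ψ (x p) ++ t p ↔ [e.1, e.2] <:+ p := by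
      intro p hp e
      obtain ⟨l, hl⟩ := hψx _ (hx p hp)
      rw [hl, List.append_assoc, List.singleton_append, suffix_append_cons_iff (ht p hp)]
      conv_rhs => rw [(hsplit p hp).1, suffix_append_cons_iff (ht p hp)]
    obtain ⟨l, hl⟩ := hψx u huX
    have hnew : ∀ e : V × V, [e.1, e.2] <:+ ψ u ++ [v] ↔ e = (u, v) := by
      intro e
      rw [hl, List.append_assoc, List.singleton_append, suffix_append_cons_iff (by simp)]
      constructor
      · intro h
        have := h.eq_of_length (by simp)
        simp only [List.cons.injEq, and_true] at this
        exact Prod.ext this.1 this.2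
      · rintro rfl; exact List.suffix_refl _
    ext e
    constructor
    · rintro (h | ⟨p, hp, h⟩)
      · exact ⟨_, Or.inr rfl, (hnew e).2 h⟩
      · exact ⟨_, Or.inl ⟨p, hp, rfl⟩, (hold p hp e).2 h⟩
    · rintro ⟨_, ⟨p, hp, rfl⟩ | rfl, h⟩
      · exact Or.inr ⟨p, hp, (hold p hp e).1 h⟩
      · exact Or.inl ((hnew e).1 h)

end Linked

/-! ### Maximal quasi-flames -/

section QuasiFlame

variable {V : Type*} {D F Z : Digraph V} {r : V}

theorem IsVertexFlame.isQuasiFlame (hF : F.IsVertexFlame r) : F.IsQuasiFlame r F :=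
  ⟨le_rfl, fun v hv _ hI _ => mem_linkedInSets_of_subset hI (hF v hv)⟩

theorem exists_maximal_isQuasiFlame (hFD : F ≤ D) (hF : F.IsVertexFlame r) :
    ∃ Z, Maximal (fun Z : Digraph V => Z ≤ D ∧ Z.IsQuasiFlame r F) Z := by
  suffices h : ∀ c ⊆ {Z : Digraph V | Z ≤ D ∧ Z.IsQuasiFlame r F}, IsChain (· ≤ ·) c →
      ∀ y ∈ c, ∃ ub ∈ {Z : Digraph V | Z ≤ D ∧ Z.IsQuasiFlame r F}, ∀ z ∈ c, z ≤ ub by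
    obtain ⟨Z, -, hZ⟩ := zorn_le_nonempty₀ _ h F ⟨hFD, hF.isQuasiFlame⟩
    exact ⟨Z, hZ⟩
  intro c hc hchain y hy
  refine ⟨sSup c, ⟨sSup_le fun Z hZ => (hc hZ).1,
    (hc hy).2.le.trans (le_sSup hy), fun v hv I hI hfin => ?_⟩, fun Z hZ => le_sSup hZ⟩
  -- Finitely many edges of the union lie in one member of the chain. The rest of `I` lies in `F`,
  -- hence in every member.
  have key : ∀ K : Set (V × V), K.Finite → K ⊆ (sSup c).inEdges v → ∃ Z ∈ c, K ⊆ Z.inEdges v := by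
    intro K hK
    induction K, hK using Set.Finite.induction_on with
    | empty => exact fun _ => ⟨y, hy, Set.empty_subset _⟩
    | @insert e K _ _ ih =>
      intro h
      obtain ⟨Z, hZ, hKZ⟩ := ih ((Set.subset_insert _ _).trans h)
      obtain ⟨⟨Z', hZ', he⟩, hev⟩ := h (Set.mem_insert _ _)
      rcases hchain.total hZ hZ' with hle | hle
      · exact ⟨Z', hZ', Set.insert_subset ⟨he, hev⟩ (hKZ.trans (inEdges_mono hle))⟩
      · exact ⟨Z, hZ, Set.insert_subset ⟨hle he, hev⟩ hKZ⟩
  obtain ⟨Z, hZ, hIZ⟩ := key _ hfin (Set.sdiff_subset.trans hI)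
  refine linkedInSets_mono (le_sSup hZ) ((hc hZ).2.mem v hv I (fun e he => ?_) hfin)
  by_cases heF : e ∈ F.inEdges v
  · exact inEdges_mono (hc hZ).2.le heF
  · exact hIZ ⟨he, heF⟩

/-- A maximal quasi-flame contains every edge that extends all linked sets at its head. -/
theorem adj_of_maximal_isQuasiFlame
    (hZ : Maximal (fun Z : Digraph V => Z ≤ D ∧ Z.IsQuasiFlame r F) Z) {u v : V}
    (huv : D.Adj u v)
    (h : ∀ Z' : Digraph V, Z ≤ Z' → Z'.Adj u v → ∀ J ∈ Z.linkedInSets r v,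
      insert (u, v) J ∈ Z'.linkedInSets r v) : Z.Adj u v := by
  let Z' : Digraph V := ⟨fun a b => Z.Adj a b ∨ (a = u ∧ b = v)⟩
  have hle : Z ≤ Z' := fun _ _ h => Or.inl h
  refine hZ.2 (y := Z') ⟨?_, hZ.1.2.le.trans hle, fun v' hv' I hI hfin => ?_⟩ hle
    (Or.inr ⟨rfl, rfl⟩)
  · rintro a b (hab | ⟨rfl, rfl⟩)
    exacts [hZ.1.1 hab, huv]
  · have hI' : ∀ e ∈ I, e ≠ (u, v) → e ∈ Z.inEdges v' := by
      intro e he hne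
      refine ⟨(hI he).1.resolve_right fun h => hne (Prod.ext h.1 h.2), (hI he).2⟩
    -- If the new edge is in `I`, then `I` without it is linked in `Z`, and `h` puts it back.
    by_cases he : (u, v) ∈ I
    · obtain rfl : v = v' := (hI he).2
      have := h Z' hle (Or.inr ⟨rfl, rfl⟩) (I \ {(u, v)}) (hZ.1.2.mem v hv' _
        (fun e he => hI' e he.1 he.2) (hfin.subset fun e he => ⟨he.1.1, he.2⟩))
      rwa [Set.insert_sdiff_singleton, Set.insert_eq_of_mem he] at this
    · exact linkedInSets_mono hle (hZ.1.2.mem v' hv' I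
        (fun e h => hI' e h fun h' => he (h' ▸ h)) hfin)

/-- The path consisting of the edge `rv` has no inner vertices, so it can join any system; the fan
is the trivial one. -/
theorem root_adj_of_maximal_isQuasiFlame
    (hZ : Maximal (fun Z : Digraph V => Z ≤ D ∧ Z.IsQuasiFlame r F) Z) {v : V} (hv : v ≠ r)
    (h : D.Adj r v) : Z.Adj r v := by
  refine adj_of_maximal_isQuasiFlame hZ h fun Z' hle hadj J hJ =>
    insert_mem_linkedInSets (A := {r}) (T := ∅) (φ := fun _ => [r]) hJ rfl hv (Set.notMem_empty _)
      (Set.disjoint_empty _) (fun a ha har => absurd ha har) rfl ?_ ?_ hle hadj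
  · rintro x (rfl | hx)
    · exact ⟨⟨rfl, rfl, by simp, by simp⟩, by simp⟩
    · exact absurd hx (Set.notMem_empty _)
  · exact fun x _ y _ _ z hz _ => by simpa using hz

theorem IsLarge.of_maximal_isQuasiFlame
    (hZ : Maximal (fun Z : Digraph V => Z ≤ D ∧ Z.IsQuasiFlame r F) Z) {L : Digraph V}
    (hL : Z.IsLarge r L) : D.IsLarge r L := by
  refine ⟨hL.le.trans hZ.1.1, fun w hw => ?_⟩
  obtain ⟨⟨Q, ⟨hQ, S, hS, hO⟩, hQL⟩, hrw⟩ := hL.largeAt w hw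
  refine ⟨⟨Q, ?_, hQL⟩, fun h => hrw (root_adj_of_maximal_isQuasiFlame hZ hw h)⟩
  obtain ⟨A, T, hrA, hwA, hwT, hAT, hcl, hQT, hfan⟩ := hQ.exists_separation_fan hS hO
  have hdel : Z.deleteEdge r w ≤ D.deleteEdge r w := fun _ _ h => ⟨hZ.1.1 h.1, h.2⟩
  have hdelZ : Z.deleteEdge r w ≤ Z := fun _ _ h => h.1
  refine ⟨⟨fun p hp => (hQ.isPath p hp).mono hdel, hQ.disjoint⟩, T,
    ⟨Set.disjoint_left.1 hAT hrA, hwT, fun p hp => ?_⟩, hQT⟩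
  by_contra! hno
  obtain ⟨i, u, v, hu, hv, huA, hvA⟩ := hp.exists_exit hrA hwA
  have hvT : v ∉ T := fun h => hno v h (List.mem_of_getElem? hv)
  have huv := hp.adj_of_index hu hv
  have hvr : v ≠ r := fun h => hvA (h ▸ hrA)
  suffices Z.Adj u v from (hcl u huA v ⟨this, huv.2⟩).elim hvA hvT
  by_cases hur : u = r
  · subst hur
    exact root_adj_of_maximal_isQuasiFlame hZ hvr huv.1
  obtain ⟨φ, hφ, hφd⟩ := hfan u huA hur
  exact adj_of_maximal_isQuasiFlame hZ huv.1 fun Z' hle hadj J hJ =>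
    insert_mem_linkedInSets hJ hrA hvA hvT hAT
      -- Away from `r`, edges of `Z` are edges of `Z - rw`, where the closure property of `A` is
      -- available.
      (fun a ha har b hab => hcl a ha b ⟨hab, fun h => har h.1⟩) huA
      (fun x hx => ⟨(hφ x hx).1.mono hdelZ, (hφ x hx).2⟩) hφd hle hadj

end QuasiFlame

end Digraph

theorem corollaryt {V : Type*} (D : Digraph V) (r : V) (F : Digraph V)
    (hFD : F ≤ D) (hF : F.IsVertexFlame r) :
    ∃ Z : Digraph V, Z ≤ D ∧ Z.IsQuasiFlame r F ∧
      ∀ L : Digraph V, Z.IsLarge r L → D.IsLarge r L := by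
  obtain ⟨Z, hZ⟩ := Digraph.exists_maximal_isQuasiFlame hFD hF
  exact ⟨Z, hZ.1.1, hZ.1.2, fun L hL => hL.of_maximal_isQuasiFlame hZ⟩
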